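/- All normed linear spaces are real. Let $X,Y$ be normed linear spaces and let $C\subset X$ be convex. A continuous mapping $F\colon C\to Y$ is called d.c. (delta-convex) on $C$ if there is a continuous function $f\colon C\to\mathbb{R}$ such that $y^*\circ F+f$ is convex on $C$ for every $y^*\in Y^*$ with $\|y^*\|\le 1$. A mapping $Q\colon Y\to Z$ between vector spaces is quadratic if there is a bilinear mapping $B\colon Y\times Y\to Z$ with $Q(y)=B(y,y)$ for all $y\in Y$; for $Z=\mathbb{R}$ it is called a quadratic form. The space $Y$ has property (D) if every continuous quadratic form on $Y$ is a difference of two nonnegative continuous quadratic forms on $Y$. A norm $|\cdot|$ on $Y$ has modulus of convexity of power type $2$ if there is $a>0$ such that $\delta(\varepsilon)\ge a\varepsilon^2$ for all $\varepsilon\in(0,2]$, where $$\delta(\varepsilon)=\inf\Bigl\{1-\tfrac12|x+y| : x,y\in Y,\ |x|=|y|=1,\ |x-y|\ge\varepsilon\Bigr\}\qquad(\inf\emptyset=+\infty).$$ **Proposition.** Let $X,Y,Z$ be normed linear spaces, $C\subset X$ an open convex set, $F\colon C\to Y$ a d.c. mapping, and $Q\colon Y\to Z$ a continuous quadratic mapping.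 Then $Q\circ F$ is d.c. on $C$, provided at least one of the following conditions is satisfied: (a) $Y$ admits an equivalent norm with modulus of convexity of power type $2$; (b) $Z$ is finite-dimensional and $Y$ has property (D). -/

import Mathlib

/-- `F` is d.c. (delta-convex) on `C`: it is continuous on `C` and there is a continuous control
function `f` such that `y* ∘ F + f` is convex on `C` for every functional `y*` of norm at most `1`.
Only the values of `F` on `C` matter. -/
def IsDCOn {X Y : Type*} [NormedAddCommGroup X] [NormedSpace ℝ X]
    [NormedAddCommGroup Y] [NormedSpace ℝ Y] (C : Set X) (F : X → Y) : Prop :=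
  ContinuousOn F C ∧ ∃ f : X → ℝ, ContinuousOn f C ∧
    ∀ φ : StrongDual ℝ Y, ‖φ‖ ≤ 1 → ConvexOn ℝ C (fun x => φ (F x) + f x)

/-- `Q` is quadratic: it is generated by a bilinear map. -/
def IsQuadratic {Y Z : Type*} [AddCommGroup Y] [Module ℝ Y] [AddCommGroup Z] [Module ℝ Z]
    (Q : Y → Z) : Prop :=
  ∃ B : LinearMap.BilinMap ℝ Y Z, ∀ y, Q y = B y y

/-- Property (D): every continuous quadratic form is a difference of two nonnegative continuous
quadratic forms. -/
def HasPropertyD (Y : Type*) [NormedAddCommGroup Y] [NormedSpace ℝ Y] : Prop :=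
  ∀ q : Y → ℝ, IsQuadratic q → Continuous q →
    ∃ q₁ q₂ : Y → ℝ, (IsQuadratic q₁ ∧ Continuous q₁ ∧ ∀ y, 0 ≤ q₁ y) ∧
      (IsQuadratic q₂ ∧ Continuous q₂ ∧ ∀ y, 0 ≤ q₂ y) ∧ ∀ y, q y = q₁ y - q₂ y

/-- The classical modulus of convexity of the (semi)norm `p`,
`δ(ε) = inf {1 - p (x + y) / 2 : p x = p y = 1, p (x - y) ≥ ε}`.
It is extended-real-valued so that the infimum over the empty set (spaces of dimension `0`)
is `+∞`. -/
noncomputable def modulusOfConvexity {Y : Type*} [AddCommGroup Y] [Module ℝ Y]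
    (p : Seminorm ℝ Y) (ε : ℝ) : EReal :=
  ⨅ (x : Y) (y : Y) (_ : p x = 1 ∧ p y = 1 ∧ ε ≤ p (x - y)), ((1 - p (x + y) / 2 : ℝ) : EReal)

/-- The modulus of convexity of `p` is of power type 2. -/
def HasModulusOfConvexityPowerTypeTwo {Y : Type*} [AddCommGroup Y] [Module ℝ Y]
    (p : Seminorm ℝ Y) : Prop :=
  ∃ a : ℝ, 0 < a ∧ ∀ ε : ℝ, 0 < ε → ε ≤ 2 → ((a * ε ^ 2 : ℝ) : EReal) ≤ modulusOfConvexity p ε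

/-- `p` is an equivalent norm on `Y` (the lower bound makes the seminorm `p` a norm). -/
def IsEquivalentNorm {Y : Type*} [NormedAddCommGroup Y] [NormedSpace ℝ Y]
    (p : Seminorm ℝ Y) : Prop :=
  ∃ m M : ℝ, 0 < m ∧ 0 < M ∧ ∀ y, m * ‖y‖ ≤ p y ∧ p y ≤ M * ‖y‖

/-! By duality, `F` is d.c. with control `f` iff the Jensen gap of `f` dominates the norm of the gap
of `F`. With `m = a F(x) + b F(y)` and `w = F(a x + b y)`, the gap of `Q ∘ F` is `a b Q(F(x) - F(y))
+ (Q m - Q w)`. The error `Q m - Q w` is at most a multiple of `‖m - w‖ (‖m‖ + ‖w‖)`, which the gap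
of `(2 f + ‖F‖)²` dominates once `f ≥ 0` (`norm_jensenGap_mul_le`). The main term needs a function
`P` on `Y` whose gap at `u, v` is at least `a b ‖Q(u - v)‖`; replacing `P` by `P ∘ F` costs an error
of the same kind (`IsDCOn.quadratic_comp`). Under (a), `P` is a multiple of the square of the
uniformly convex norm; under (b), a weighted sum of nonnegative quadratic forms. -/

/-- The defect in Jensen's (in)equality for `f` at the points `x`, `y` with weights `a`, `b`. -/
def jensenGap {X E : Type*} [AddCommGroup X] [Module ℝ X] [AddCommGroup E] [Module ℝ E]
    (f : X → E) (a b : ℝ) (x y : X) : E :=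
  a • f x + b • f y - f (a • x + b • y)

theorem convexOn_iff_jensenGap_nonneg {X : Type*} [AddCommGroup X] [Module ℝ X]
    {C : Set X} (hC : Convex ℝ C) {f : X → ℝ} :
    ConvexOn ℝ C f ↔ ∀ x ∈ C, ∀ y ∈ C, ∀ a b : ℝ, 0 ≤ a → 0 ≤ b → a + b = 1 →
      0 ≤ jensenGap f a b x y := by
  constructor
  · intro h x hx y hy a b ha hb hab
    exact sub_nonneg.2 (h.2 hx hy ha hb hab)
  · intro h
    exact ⟨hC, fun x hx y hy a b ha hb hab => sub_nonneg.1 (h x hx y hy a b ha hb hab)⟩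

/-- A map is d.c. with control function `f` iff the norm of its Jensen gap is dominated by
that of `f`. -/
theorem forall_convexOn_dual_add_iff {X Y : Type*} [NormedAddCommGroup X] [NormedSpace ℝ X]
    [NormedAddCommGroup Y] [NormedSpace ℝ Y] {C : Set X} (hC : Convex ℝ C) {F : X → Y}
    {f : X → ℝ} :
    (∀ φ : StrongDual ℝ Y, ‖φ‖ ≤ 1 → ConvexOn ℝ C (fun x => φ (F x) + f x)) ↔
      ∀ x ∈ C, ∀ y ∈ C, ∀ a b : ℝ, 0 ≤ a → 0 ≤ b → a + b = 1 →
        ‖jensenGap F a b x y‖ ≤ jensenGap f a b x y := by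
  have key (φ : StrongDual ℝ Y) (a b : ℝ) (x y : X) :
      jensenGap (fun x => φ (F x) + f x) a b x y =
        φ (jensenGap F a b x y) + jensenGap f a b x y := by
    simp only [jensenGap, map_sub, map_add, map_smul, smul_eq_mul]
    ring
  constructor
  · intro h x hx y hy a b ha hb hab
    obtain ⟨φ, hφ, hφx⟩ := exists_dual_vector'' ℝ (jensenGap F a b x y)
    have := (convexOn_iff_jensenGap_nonneg hC).1 (h (-φ) (by simpa using hφ)) x hx y hy a b ha hb hab
    rw [key] at this
    simp only [neg_apply, hφx] at this
    simp only [RCLike.ofReal_real_eq_id, id] at this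
    linarith
  · intro h φ hφ
    refine (convexOn_iff_jensenGap_nonneg hC).2 fun x hx y hy a b ha hb hab => ?_
    rw [key]
    have h1 := h x hx y hy a b ha hb hab
    have h2 := φ.le_of_opNorm_le hφ (jensenGap F a b x y)
    have h3 := neg_le_of_abs_le (Real.norm_eq_abs _ ▸ h2)
    linarith

/-! ### Nonnegative control functions -/

/-- A continuous convex function on an open convex set has a continuous affine minorant. -/
theorem ConvexOn.exists_continuous_affine_minorant {X : Type*} [NormedAddCommGroup X]
    [NormedSpace ℝ X] {C : Set X} (hCo : IsOpen C) {f : X → ℝ} (hf : ConvexOn ℝ C f)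
    (hfc : ContinuousOn f C) :
    ∃ (l : StrongDual ℝ X) (c : ℝ), ∀ x ∈ C, l x + c ≤ f x := by
  rcases C.eq_empty_or_nonempty with rfl | ⟨x₀, hx₀⟩
  · exact ⟨0, 0, by simp⟩
  have hopen : IsOpen {p : X × ℝ | p.1 ∈ C ∧ f p.1 < p.2} := by
    have hC' : IsOpen (Prod.fst ⁻¹' C : Set (X × ℝ)) := hCo.preimage continuous_fst
    have hg : ContinuousOn (fun p : X × ℝ => p.2 - f p.1) (Prod.fst ⁻¹' C) :=
      continuous_snd.continuousOn.sub (hfc.comp continuous_fst.continuousOn fun p hp => hp)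
    convert hg.isOpen_inter_preimage hC' (isOpen_Ioi (a := (0 : ℝ))) using 1
    ext p
    simp
  obtain ⟨L, hL⟩ := geometric_hahn_banach_point_open hf.convex_strict_epigraph hopen
    (x := (x₀, f x₀)) (by simp)
  have hsplit (x : X) (t : ℝ) : L (x, t) = L (x, 0) + t * L (0, 1) := by
    rw [← smul_eq_mul, ← map_smul, ← map_add]
    simp
  -- The separating hyperplane is not vertical: the epigraph contains a point directly above `(x₀, f
  -- x₀)`.
  have hpos : 0 < L (0, 1) := by
    have := hL (x₀, f x₀ + 1) ⟨hx₀, by simp⟩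
    rw [hsplit x₀ (f x₀), hsplit x₀ (f x₀ + 1)] at this
    linarith
  set c := L (0, 1)
  refine ⟨-c⁻¹ • L.comp (.inl ℝ X ℝ), c⁻¹ * L (x₀, f x₀), fun x hx => ?_⟩
  have hle : L (x₀, f x₀) ≤ L (x, 0) + f x * c := by
    refine le_of_forall_pos_le_add fun ε hε => ?_
    have := hL (x, f x + ε / c) ⟨hx, by simpa using div_pos hε hpos⟩
    rw [hsplit x, add_mul, div_mul_cancel₀ _ hpos.ne'] at this
    linarith
  have : c⁻¹ * L (x₀, f x₀) ≤ c⁻¹ * L (x, 0) + f x := by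
    calc c⁻¹ * L (x₀, f x₀) ≤ c⁻¹ * (L (x, 0) + f x * c) :=
          mul_le_mul_of_nonneg_left hle (inv_pos.2 hpos).le
      _ = c⁻¹ * L (x, 0) + f x := by field_simp
  simp only [smul_apply, ContinuousLinearMap.comp_apply,
    ContinuousLinearMap.inl_apply, smul_eq_mul]
  linarith

/-- The control function of a d.c. map on an open convex set can be chosen nonnegative. -/
theorem IsDCOn.exists_nonneg_control {X Y : Type*} [NormedAddCommGroup X] [NormedSpace ℝ X]
    [NormedAddCommGroup Y] [NormedSpace ℝ Y] {C : Set X} (hCo : IsOpen C) (hC : Convex ℝ C)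
    {F : X → Y} (hF : IsDCOn C F) :
    ∃ f : X → ℝ, ContinuousOn f C ∧ (∀ x ∈ C, 0 ≤ f x) ∧
      ∀ x ∈ C, ∀ y ∈ C, ∀ a b : ℝ, 0 ≤ a → 0 ≤ b → a + b = 1 →
        ‖jensenGap F a b x y‖ ≤ jensenGap f a b x y := by
  obtain ⟨-, f, hfc, hf⟩ := hF
  have hfcv : ConvexOn ℝ C f := by simpa using hf 0 (by simp)
  obtain ⟨l, c, hl⟩ := hfcv.exists_continuous_affine_minorant hCo hfc
  -- Affine functions have zero gap, so subtracting the minorant leaves the gap of `f` unchanged.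
  refine ⟨fun x => f x - (l x + c), hfc.sub (by fun_prop), fun x hx => sub_nonneg.2 (hl x hx),
    fun x hx y hy a b ha hb hab => ?_⟩
  have := (forall_convexOn_dual_add_iff hC).1 hf x hx y hy a b ha hb hab
  refine this.trans_eq ?_
  simp only [jensenGap, smul_eq_mul, map_add, map_smul]
  linear_combination c * hab

/-- If `f ≥ 0` dominates the Jensen gap of `F`, then the Jensen gap of `(2 f + ‖F‖)²` dominates
`‖m - w‖ (‖m‖ + ‖w‖)`, where `m` is the mean of the values of `F` and `w` the value of `F` at the
mean. -/
theorem norm_jensenGap_mul_le {X Y : Type*} [NormedAddCommGroup X] [NormedSpace ℝ X]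
    [NormedAddCommGroup Y] [NormedSpace ℝ Y] {F : X → Y} {f : X → ℝ} {x y : X} {a b : ℝ}
    (ha : 0 ≤ a) (hb : 0 ≤ b) (hab : a + b = 1) (hx : 0 ≤ f x) (hy : 0 ≤ f y)
    (hz : 0 ≤ f (a • x + b • y)) (h : ‖jensenGap F a b x y‖ ≤ jensenGap f a b x y) :
    ‖jensenGap F a b x y‖ * (‖a • F x + b • F y‖ + ‖F (a • x + b • y)‖) ≤
      jensenGap (fun x => (2 * f x + ‖F x‖) ^ 2) a b x y := by
  simp only [jensenGap, smul_eq_mul] at h ⊢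
  set m := a • F x + b • F y
  set w := F (a • x + b • y)
  set fz := f (a • x + b • y)
  have hmn : ‖m‖ ≤ a * ‖F x‖ + b * ‖F y‖ := by
    refine (norm_add_le _ _).trans_eq ?_
    rw [norm_smul, norm_smul, Real.norm_of_nonneg ha, Real.norm_of_nonneg hb]
  have hw : ‖w‖ ≤ ‖m‖ + ‖m - w‖ := by
    have := norm_sub_le m (m - w)
    simpa using this
  have hfx : 0 ≤ a * f x := mul_nonneg ha hx
  have hfy : 0 ≤ b * f y := mul_nonneg hb hy
  set s := 2 * f x + ‖F x‖
  set t := 2 * f y + ‖F y‖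
  have hsq : (a * s + b * t) ^ 2 ≤ a * s ^ 2 + b * t ^ 2 := by
    have hb' : b = 1 - a := by linarith
    have : a * s ^ 2 + b * t ^ 2 - (a * s + b * t) ^ 2 = a * b * (s - t) ^ 2 := by
      subst hb'; ring
    have h0 : 0 ≤ a * b * (s - t) ^ 2 := by positivity
    linarith
  have hst : a * s + b * t = 2 * (a * f x + b * f y) + (a * ‖F x‖ + b * ‖F y‖) := by ring
  set r := 2 * fz + ‖w‖
  -- The factor 2 pays twice for `‖m - w‖`: once for `‖w‖` exceeding `‖m‖`, once for the bound
  -- itself. The product of `h1` and `h2` is a difference of squares.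
  have h1 : ‖m - w‖ ≤ a * s + b * t - r := by simp only [hst, r]; linarith
  have h2 : ‖m‖ + ‖w‖ ≤ a * s + b * t + r := by simp only [hst, r]; linarith
  have := mul_le_mul h1 h2 (by positivity) ((norm_nonneg _).trans h1)
  nlinarith

/-! ### Quadratic maps -/

theorem jensenGap_quadratic {Y Z : Type*} [AddCommGroup Y] [Module ℝ Y] [AddCommGroup Z]
    [Module ℝ Z] {Q : Y → Z} (hQ : IsQuadratic Q) {a b : ℝ} (hab : a + b = 1) (u v : Y) :
    jensenGap Q a b u v = (a * b) • Q (u - v) := by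
  obtain ⟨B, hB⟩ := hQ
  obtain rfl : b = 1 - a := by linarith
  simp only [jensenGap, hB, map_add, map_sub, map_smul, LinearMap.add_apply, LinearMap.sub_apply,
    LinearMap.smul_apply]
  module

theorem IsQuadratic.map_smul {Y Z : Type*} [AddCommGroup Y] [Module ℝ Y] [AddCommGroup Z]
    [Module ℝ Z] {Q : Y → Z} (hQ : IsQuadratic Q) (t : ℝ) (y : Y) : Q (t • y) = t ^ 2 • Q y := by
  obtain ⟨B, hB⟩ := hQ
  simp only [hB, _root_.map_smul, LinearMap.smul_apply]
  module

theorem IsQuadratic.comp_linearMap {Y Z W : Type*} [AddCommGroup Y] [Module ℝ Y]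
    [AddCommGroup Z] [Module ℝ Z] [AddCommGroup W] [Module ℝ W] {Q : Y → Z} (hQ : IsQuadratic Q)
    (g : Z →ₗ[ℝ] W) : IsQuadratic (fun y => g (Q y)) := by
  obtain ⟨B, hB⟩ := hQ
  exact ⟨B.compr₂ g, fun y => by simp [hB]⟩

/-- A continuous quadratic map is bounded by a multiple of the squared norm. -/
theorem IsQuadratic.exists_norm_le {Y Z : Type*} [NormedAddCommGroup Y] [NormedSpace ℝ Y]
    [NormedAddCommGroup Z] [NormedSpace ℝ Z] {Q : Y → Z} (hQ : IsQuadratic Q)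
    (hQc : Continuous Q) : ∃ K : ℝ, 0 ≤ K ∧ ∀ y, ‖Q y‖ ≤ K * ‖y‖ ^ 2 := by
  have h0 : Q 0 = 0 := by simpa using hQ.map_smul 0 0
  obtain ⟨δ, hδ, h⟩ := Metric.continuous_iff.1 hQc 0 1 one_pos
  simp only [h0, dist_zero_right] at h
  refine ⟨(2 / δ) ^ 2, by positivity, fun y => ?_⟩
  rcases eq_or_ne y 0 with rfl | hy
  · simp [h0]
  have hy' : 0 < ‖y‖ := norm_pos_iff.2 hy
  have := h ((δ / 2 / ‖y‖) • y) (by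
    rw [norm_smul, Real.norm_of_nonneg (by positivity), div_mul_cancel₀ _ hy'.ne']
    linarith)
  rw [hQ.map_smul, norm_smul, Real.norm_of_nonneg (by positivity)] at this
  have h2 : ‖Q y‖ = (2 / δ) ^ 2 * ‖y‖ ^ 2 * ((δ / 2 / ‖y‖) ^ 2 * ‖Q y‖) := by field_simp
  rw [h2]
  exact mul_le_of_le_one_right (by positivity) this.le

/-- Twice the difference is `B (m + w) (m - w) + B (m - w) (m + w)`. Continuity is known only for
`Q`, so this is polarized as `Q (p + q) - Q (p - q)`, with `p`, `q` rescaled to equal norms so that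
the bound becomes a product. -/
theorem IsQuadratic.exists_norm_sub_le {Y Z : Type*} [NormedAddCommGroup Y] [NormedSpace ℝ Y]
    [NormedAddCommGroup Z] [NormedSpace ℝ Z] {Q : Y → Z} (hQ : IsQuadratic Q)
    (hQc : Continuous Q) :
    ∃ K : ℝ, 0 ≤ K ∧ ∀ m w, ‖Q m - Q w‖ ≤ K * (‖m - w‖ * (‖m‖ + ‖w‖)) := by
  obtain ⟨K, hK0, hK⟩ := hQ.exists_norm_le hQc
  refine ⟨2 * K, by positivity, fun m w => ?_⟩
  have hs : ‖m + w‖ ≤ ‖m‖ + ‖w‖ := norm_add_le m w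
  suffices h : ‖Q m - Q w‖ ≤ 2 * K * (‖m - w‖ * ‖m + w‖) from h.trans (by gcongr)
  rcases eq_or_ne (m - w) 0 with h0 | h0
  · simp [sub_eq_zero.1 h0]
  rcases eq_or_ne (m + w) 0 with h1 | h1
  · have : w = (-1 : ℝ) • m := by rw [neg_one_smul]; exact (neg_eq_of_add_eq_zero_right h1).symm
    have hQw : Q w = Q m := by rw [this, hQ.map_smul]; simp
    simp [hQw, h1]
  have hd0 : 0 < ‖m - w‖ := norm_pos_iff.2 h0
  have hs0 : 0 < ‖m + w‖ := norm_pos_iff.2 h1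
  set t := √(‖m + w‖ / ‖m - w‖)
  have ht0 : 0 < t := Real.sqrt_pos.2 (by positivity)
  have ht2 : t ^ 2 = ‖m + w‖ / ‖m - w‖ := Real.sq_sqrt (by positivity)
  set p := t⁻¹ • (m + w)
  set q := t • (m - w)
  have hpol : Q m - Q w = (4⁻¹ : ℝ) • (Q (p + q) - Q (p - q)) := by
    obtain ⟨B, hB⟩ := hQ
    have hpq : B p q = B (m + w) (m - w) := by
      simp only [p, q, _root_.map_smul, LinearMap.smul_apply, smul_smul,
        mul_inv_cancel₀ ht0.ne', one_smul]
    have hqp : B q p = B (m - w) (m + w) := by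
      simp only [p, q, _root_.map_smul, LinearMap.smul_apply, smul_smul,
        inv_mul_cancel₀ ht0.ne', one_smul]
    have : Q (p + q) - Q (p - q) = (2 : ℝ) • (B p q + B q p) := by
      simp only [hB, map_add, map_sub, LinearMap.add_apply, LinearMap.sub_apply]
      module
    rw [this, hpq, hqp]
    simp only [hB, map_add, map_sub, LinearMap.add_apply, LinearMap.sub_apply]
    module
  have hpn : ‖p‖ ^ 2 = ‖m - w‖ * ‖m + w‖ := by
    rw [norm_smul, mul_pow, norm_inv, inv_pow, Real.norm_of_nonneg ht0.le, ht2]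
    field_simp
  have hqn : ‖q‖ ^ 2 = ‖m - w‖ * ‖m + w‖ := by
    rw [norm_smul, mul_pow, Real.norm_of_nonneg ht0.le, ht2]
    field_simp
  have hpq : ‖p‖ = ‖q‖ := by
    rw [← sq_eq_sq₀ (norm_nonneg _) (norm_nonneg _), hpn, hqn]
  have hpar : ‖Q (p + q) - Q (p - q)‖ ≤ 8 * (K * (‖m - w‖ * ‖m + w‖)) := by
    have h1 : ‖Q (p + q)‖ ≤ K * (‖p‖ + ‖q‖) ^ 2 :=
      (hK _).trans (by gcongr; exact norm_add_le p q)
    have h2 : ‖Q (p - q)‖ ≤ K * (‖p‖ + ‖q‖) ^ 2 :=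
      (hK _).trans (by gcongr; exact norm_sub_le p q)
    rw [← hpq] at h1 h2
    rw [← hpn]
    linarith [norm_sub_le (Q (p + q)) (Q (p - q))]
  rw [hpol, norm_smul, Real.norm_of_nonneg (by norm_num)]
  linarith

/-- If a continuous quadratic map `Q` has a continuous "control function" `P` which is Lipschitz in
the way quadratic functions are, then `Q ∘ F` is d.c. for every d.c. map `F`. -/
theorem IsDCOn.quadratic_comp {X Y Z : Type*} [NormedAddCommGroup X] [NormedSpace ℝ X]
    [NormedAddCommGroup Y] [NormedSpace ℝ Y] [NormedAddCommGroup Z] [NormedSpace ℝ Z]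
    {C : Set X} (hCo : IsOpen C) (hC : Convex ℝ C) {F : X → Y} (hF : IsDCOn C F)
    {Q : Y → Z} (hQ : IsQuadratic Q) (hQc : Continuous Q) {P : Y → ℝ} (hPc : Continuous P)
    {K : ℝ} (hK : 0 ≤ K) (hPK : ∀ m w, |P m - P w| ≤ K * (‖m - w‖ * (‖m‖ + ‖w‖)))
    (hPQ : ∀ u v a b, 0 ≤ a → 0 ≤ b → a + b = 1 → a * b * ‖Q (u - v)‖ ≤ jensenGap P a b u v) :
    IsDCOn C (fun x => Q (F x)) := by
  obtain ⟨L, hL0, hL⟩ := hQ.exists_norm_sub_le hQc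
  obtain ⟨f, hfc, hf0, hf⟩ := hF.exists_nonneg_control hCo hC
  refine ⟨hQc.comp_continuousOn hF.1,
    fun x => P (F x) + (K + L) * (2 * f x + ‖F x‖) ^ 2, ?_, ?_⟩
  · exact (hPc.comp_continuousOn hF.1).add
      (continuousOn_const.mul (((continuousOn_const.mul hfc).add hF.1.norm).pow 2))
  refine (forall_convexOn_dual_add_iff hC).2 fun x hx y hy a b ha hb hab => ?_
  have hE := norm_jensenGap_mul_le ha hb hab (hf0 x hx) (hf0 y hy) (hf0 _ (hC hx hy ha hb hab))
    (hf x hx y hy a b ha hb hab)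
  set m := a • F x + b • F y with hm
  set w := F (a • x + b • y) with hw
  have hgap : jensenGap F a b x y = m - w := rfl
  rw [hgap] at hE
  have hgQ : jensenGap (fun x => Q (F x)) a b x y = (a * b) • Q (F x - F y) + (Q m - Q w) := by
    rw [← jensenGap_quadratic hQ hab]
    simp only [jensenGap, hm, hw]
    abel
  have hgP : jensenGap (fun x => P (F x) + (K + L) * (2 * f x + ‖F x‖) ^ 2) a b x y =
      jensenGap P a b (F x) (F y) + (P m - P w) +
        (K + L) * jensenGap (fun x => (2 * f x + ‖F x‖) ^ 2) a b x y := by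
    simp only [jensenGap, hm, hw, smul_eq_mul]
    ring
  rw [hgQ, hgP]
  have h1 := norm_add_le ((a * b) • Q (F x - F y)) (Q m - Q w)
  rw [norm_smul, Real.norm_of_nonneg (mul_nonneg ha hb)] at h1
  have h2 := hPQ (F x) (F y) a b ha hb hab
  have h3 := hL m w
  have h4 := neg_le_of_abs_le (hPK m w)
  have h5 := mul_le_mul_of_nonneg_left hE (add_nonneg hK hL0)
  linarith

/-! ### Norms of power type 2 -/

/-- A norm with modulus of convexity of power type two satisfies a quadratic improvement of
the midpoint convexity of its square. -/
theorem HasModulusOfConvexityPowerTypeTwo.exists_midpoint_le {Y : Type*} [AddCommGroup Y]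
    [Module ℝ Y] {p : Seminorm ℝ Y} (hp : HasModulusOfConvexityPowerTypeTwo p) :
    ∃ c : ℝ, 0 < c ∧ ∀ u v, c * p (u - v) ^ 2 ≤ p u ^ 2 / 2 + p v ^ 2 / 2 - (p (u + v) / 2) ^ 2 := by
  obtain ⟨a, ha, h⟩ := hp
  have hunit (x y : Y) (hx : p x = 1) (hy : p y = 1) :
      a * p (x - y) ^ 2 ≤ 1 - p (x + y) / 2 := by
    rcases (apply_nonneg p (x - y)).eq_or_lt with h0 | h0
    · rw [← h0]
      linarith [map_add_le_add p x y]
    · have h2 : p (x - y) ≤ 2 := by linarith [map_sub_le_add p x y]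
      have := (h _ h0 h2).trans (iInf_le_of_le x (iInf_le_of_le y (iInf_le_of_le ⟨hx, hy, le_rfl⟩
        le_rfl)))
      exact EReal.coe_le_coe_iff.1 this
  -- `1/4` is the coefficient of `(r - s)²` in `hid`, `a` comes from the unit sphere, and the final
  -- halving from `(α + β)² ≤ 2 (α² + β²)`.
  refine ⟨min (1 / 4) a / 2, by positivity, ?_⟩
  set c := min (1 / 4) a
  have hc4 : c ≤ 1 / 4 := min_le_left _ _
  have hca : c ≤ a := min_le_right _ _
  have hc0 : 0 < c := lt_min (by norm_num) ha
  have main (u v : Y) (huv : p v ≤ p u) :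
      c / 2 * p (u - v) ^ 2 ≤ p u ^ 2 / 2 + p v ^ 2 / 2 - (p (u + v) / 2) ^ 2 := by
    have hadd := map_add_le_add p u v
    have hsub := map_sub_le_add p u v
    have hadd0 := apply_nonneg p (u + v)
    have hsub0 := apply_nonneg p (u - v)
    rcases (apply_nonneg p v).eq_or_lt with hv | hv
    · rw [← hv] at hadd hsub ⊢
      have h1 : p (u + v) ^ 2 ≤ p u ^ 2 := by gcongr; linarith
      have h2 : p (u - v) ^ 2 ≤ p u ^ 2 := by gcongr; linarith
      nlinarith [sq_nonneg (p u), mul_le_mul_of_nonneg_left h2 hc0.le,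
        mul_le_mul_of_nonneg_right hc4 (sq_nonneg (p u))]
    have hu : 0 < p u := hv.trans_le huv
    set r := p u
    set s := p v
    set x := r⁻¹ • u with hxdef
    set y := s⁻¹ • v with hydef
    have hx : p x = 1 := by
      rw [hxdef, map_smul_eq_mul, norm_inv, Real.norm_of_nonneg hu.le, inv_mul_cancel₀ hu.ne']
    have hy : p y = 1 := by
      rw [hydef, map_smul_eq_mul, norm_inv, Real.norm_of_nonneg hv.le, inv_mul_cancel₀ hv.ne']
    have hux : u = r • x := by rw [hxdef, smul_inv_smul₀ hu.ne']
    have hvy : v = s • y := by rw [hydef, smul_inv_smul₀ hv.ne']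
    have hδ := hunit x y hx hy
    set e := p (x - y)
    have he : 0 ≤ e := apply_nonneg p _
    have hsum : p (u + v) ≤ s * p (x + y) + (r - s) := by
      have : u + v = s • (x + y) + (r - s) • x := by rw [hux, hvy]; module
      rw [this]
      refine (map_add_le_add p _ _).trans_eq ?_
      rw [map_smul_eq_mul, map_smul_eq_mul, hx, Real.norm_of_nonneg hv.le,
        Real.norm_of_nonneg (sub_nonneg.2 huv), mul_one]
    have hdiff : p (u - v) ≤ s * e + (r - s) := by
      have : u - v = s • (x - y) + (r - s) • x := by rw [hux, hvy]; module
      rw [this]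
      refine (map_add_le_add p _ _).trans_eq ?_
      rw [map_smul_eq_mul, map_smul_eq_mul, hx, Real.norm_of_nonneg hv.le,
        Real.norm_of_nonneg (sub_nonneg.2 huv), mul_one]
    set d := a * e ^ 2 with hd
    have hd0 : 0 ≤ d := by positivity
    have hd1 : d ≤ 1 := by linarith [apply_nonneg p (x + y)]
    have hsum' : p (u + v) / 2 ≤ (r + s) / 2 - s * d := by
      have : s * p (x + y) ≤ s * (2 * (1 - d)) := by gcongr; linarith
      linarith
    have hsq : (p (u + v) / 2) ^ 2 ≤ ((r + s) / 2 - s * d) ^ 2 :=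
      pow_le_pow_left₀ (by positivity) hsum' 2
    have hid : r ^ 2 / 2 + s ^ 2 / 2 - ((r + s) / 2 - s * d) ^ 2 =
        1 / 4 * (r - s) ^ 2 + d * s ^ 2 + s * d * (r - s) + s ^ 2 * d * (1 - d) := by
      ring
    have h3 : 0 ≤ s * d * (r - s) := by
      have := sub_nonneg.2 huv
      positivity
    have h4 : 0 ≤ s ^ 2 * d * (1 - d) := by
      have := sub_nonneg.2 hd1
      positivity
    have h5 : c * (r - s) ^ 2 ≤ 1 / 4 * (r - s) ^ 2 := by gcongr
    have h6 : c * (s * e) ^ 2 ≤ d * s ^ 2 := by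
      calc c * (s * e) ^ 2 ≤ a * (s * e) ^ 2 := by gcongr
        _ = d * s ^ 2 := by rw [hd]; ring
    have h7 : p (u - v) ^ 2 ≤ (s * e + (r - s)) ^ 2 := by gcongr
    have h8 : (s * e + (r - s)) ^ 2 ≤ 2 * ((s * e) ^ 2 + (r - s) ^ 2) := add_sq_le
    have h9 := mul_le_mul_of_nonneg_left (h7.trans h8) hc0.le
    linarith
  intro u v
  rcases le_total (p v) (p u) with h1 | h1
  · exact main u v h1
  · have := main v u h1
    rw [map_sub_rev p v u, add_comm v u] at this
    linarith

/-- A quadratic improvement of midpoint convexity extends to all convex combinations. -/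
theorem Seminorm.mul_sq_le_jensenGap_sq {Y : Type*} [AddCommGroup Y] [Module ℝ Y]
    {p : Seminorm ℝ Y} {c : ℝ} (hc : 0 ≤ c)
    (h : ∀ u v, c * p (u - v) ^ 2 ≤ p u ^ 2 / 2 + p v ^ 2 / 2 - (p (u + v) / 2) ^ 2)
    (u v : Y) {a b : ℝ} (ha : 0 ≤ a) (hb : 0 ≤ b) (hab : a + b = 1) :
    a * b * (2 * c * p (u - v) ^ 2) ≤ jensenGap (fun y => p y ^ 2) a b u v := by
  have main (u v : Y) (a b : ℝ) (ha : 0 ≤ a) (hab : a + b = 1) (hle : a ≤ b) :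
      a * b * (2 * c * p (u - v) ^ 2) ≤ a * p u ^ 2 + b * p v ^ 2 - p (a • u + b • v) ^ 2 := by
    obtain rfl : b = 1 - a := by linarith
    -- For `a ≤ 1/2` the point lies between the midpoint and `v`, with weights `2a` and `1 - 2a`.
    have h1 : p (a • u + (1 - a) • v) ≤ 2 * a * (p (u + v) / 2) + (1 - 2 * a) * p v := by
      have : a • u + (1 - a) • v = a • (u + v) + (1 - 2 * a) • v := by module
      rw [this]
      refine (map_add_le_add p _ _).trans_eq ?_
      rw [map_smul_eq_mul, map_smul_eq_mul, Real.norm_of_nonneg ha,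
        Real.norm_of_nonneg (by linarith)]
      ring
    have h2 := pow_le_pow_left₀ (apply_nonneg p _) h1 2
    have h4 := mul_le_mul_of_nonneg_left (h u v) (by linarith : 0 ≤ 2 * a)
    set m := p (u + v) / 2
    have h3 : (2 * a * m + (1 - 2 * a) * p v) ^ 2 ≤ 2 * a * m ^ 2 + (1 - 2 * a) * p v ^ 2 := by
      have : 0 ≤ 2 * a * (1 - 2 * a) * (m - p v) ^ 2 :=
        mul_nonneg (mul_nonneg (by linarith) (by linarith)) (sq_nonneg _)
      linarith
    have h5 : 0 ≤ a ^ 2 * (2 * c * p (u - v) ^ 2) := by positivity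
    linarith
  simp only [jensenGap, smul_eq_mul]
  rcases le_total a b with hle | hle
  · exact main u v a b ha hab hle
  · have := main v u b a hb (by linarith) hle
    rw [map_sub_rev p v u, add_comm (b • v)] at this
    linarith

/-! ### The two cases -/

theorem IsDCOn.quadratic_comp_of_powerTypeTwo {X Y Z : Type*} [NormedAddCommGroup X]
    [NormedSpace ℝ X] [NormedAddCommGroup Y] [NormedSpace ℝ Y] [NormedAddCommGroup Z]
    [NormedSpace ℝ Z] {C : Set X} (hCo : IsOpen C) (hC : Convex ℝ C) {F : X → Y}
    (hF : IsDCOn C F) {Q : Y → Z} (hQ : IsQuadratic Q) (hQc : Continuous Q) {p : Seminorm ℝ Y}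
    (hp : IsEquivalentNorm p) (hp2 : HasModulusOfConvexityPowerTypeTwo p) :
    IsDCOn C (fun x => Q (F x)) := by
  obtain ⟨m, M, hm, hM, hmM⟩ := hp
  obtain ⟨c, hc, hmid⟩ := hp2.exists_midpoint_le
  obtain ⟨K, hK, hQK⟩ := hQ.exists_norm_le hQc
  have hplip (u v : Y) : |p u - p v| ≤ M * ‖u - v‖ :=
    (abs_sub_map_le_sub p u v).trans (hmM _).2
  have hpc : Continuous p :=
    (LipschitzWith.of_dist_le' (K := M) fun u v => by
      rw [Real.dist_eq, dist_eq_norm]; exact hplip u v).continuous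
  -- Chosen so that `2 c A p² ≥ K ‖·‖²`, by the lower bound `m ‖·‖ ≤ p`.
  set A := K / m ^ 2 / (2 * c) with hA
  have hA0 : 0 ≤ A := by positivity
  refine hF.quadratic_comp hCo hC hQ hQc (P := fun y => A * p y ^ 2) (K := A * (M * M))
    (by fun_prop) (by positivity) ?_ ?_
  · intro u v
    have h1 : A * p u ^ 2 - A * p v ^ 2 = A * ((p u - p v) * (p u + p v)) := by ring
    rw [h1, abs_mul, abs_mul, abs_of_nonneg hA0, mul_assoc]
    have h2 : |p u + p v| ≤ M * (‖u‖ + ‖v‖) := by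
      rw [abs_of_nonneg (add_nonneg (apply_nonneg p u) (apply_nonneg p v)), mul_add]
      exact add_le_add (hmM u).2 (hmM v).2
    have h3 := mul_le_mul (hplip u v) h2 (abs_nonneg _) (by positivity)
    exact mul_le_mul_of_nonneg_left (h3.trans_eq (by ring)) hA0
  · intro u v a b ha hb hab
    have h1 := mul_le_mul_of_nonneg_left (p.mul_sq_le_jensenGap_sq hc.le hmid u v ha hb hab) hA0
    have h2 : A * jensenGap (fun y => p y ^ 2) a b u v =
        jensenGap (fun y => A * p y ^ 2) a b u v := by
      simp only [jensenGap, smul_eq_mul]; ring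
    rw [← h2]
    refine le_trans ?_ h1
    have h3 : A * (a * b * (2 * c * p (u - v) ^ 2)) = a * b * (K / m ^ 2 * p (u - v) ^ 2) := by
      rw [hA]; field_simp
    rw [h3]
    refine mul_le_mul_of_nonneg_left ((hQK _).trans ?_) (mul_nonneg ha hb)
    calc K * ‖u - v‖ ^ 2 = K / m ^ 2 * (m * ‖u - v‖) ^ 2 := by field_simp
      _ ≤ K / m ^ 2 * p (u - v) ^ 2 := by
          gcongr
          exact (hmM _).1

/-- Each coordinate of `Q` is some `q₁ - q₂`, of modulus at most `q₁ + q₂`; the gap of this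
quadratic form is exactly `a b` times its value at `u - v`. -/
theorem IsDCOn.quadratic_comp_of_hasPropertyD {X Y Z : Type*} [NormedAddCommGroup X]
    [NormedSpace ℝ X] [NormedAddCommGroup Y] [NormedSpace ℝ Y] [NormedAddCommGroup Z]
    [NormedSpace ℝ Z] [FiniteDimensional ℝ Z] {C : Set X} (hCo : IsOpen C) (hC : Convex ℝ C)
    {F : X → Y} (hF : IsDCOn C F) {Q : Y → Z} (hQ : IsQuadratic Q) (hQc : Continuous Q)
    (hY : HasPropertyD Y) : IsDCOn C (fun x => Q (F x)) := by
  let e := Module.finBasis ℝ Z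
  have hcoord (i) : Continuous (e.coord i) := LinearMap.continuous_of_finiteDimensional _
  choose q₁ q₂ h₁ h₂ hq using fun i =>
    hY (fun y => e.coord i (Q y)) (hQ.comp_linearMap _) ((hcoord i).comp hQc)
  choose K₁ hK₁ hL₁ using fun i => (h₁ i).1.exists_norm_sub_le (h₁ i).2.1
  choose K₂ hK₂ hL₂ using fun i => (h₂ i).1.exists_norm_sub_le (h₂ i).2.1
  have hc₁ (i) : Continuous (q₁ i) := (h₁ i).2.1
  have hc₂ (i) : Continuous (q₂ i) := (h₂ i).2.1
  refine hF.quadratic_comp hCo hC hQ hQc (P := fun y => ∑ i, ‖e i‖ * (q₁ i y + q₂ i y))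
    (K := ∑ i, ‖e i‖ * (K₁ i + K₂ i)) (by fun_prop)
    (Finset.sum_nonneg fun i _ => mul_nonneg (norm_nonneg _) (add_nonneg (hK₁ i) (hK₂ i))) ?_ ?_
  · intro m w
    rw [← Finset.sum_sub_distrib, Finset.sum_mul]
    refine (Finset.abs_sum_le_sum_abs _ _).trans (Finset.sum_le_sum fun i _ => ?_)
    rw [← mul_sub, abs_mul, abs_norm, mul_assoc]
    refine mul_le_mul_of_nonneg_left ?_ (norm_nonneg _)
    rw [add_sub_add_comm, add_mul]
    exact (abs_add_le _ _).trans (add_le_add (hL₁ i m w) (hL₂ i m w))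
  · intro u v a b ha hb hab
    have hgap : jensenGap (fun y => ∑ i, ‖e i‖ * (q₁ i y + q₂ i y)) a b u v =
        a * b * ∑ i, ‖e i‖ * (q₁ i (u - v) + q₂ i (u - v)) := by
      have hi (i) : a * b * (q₁ i (u - v) + q₂ i (u - v)) =
          jensenGap (q₁ i) a b u v + jensenGap (q₂ i) a b u v := by
        rw [jensenGap_quadratic (h₁ i).1 hab, jensenGap_quadratic (h₂ i).1 hab, smul_eq_mul,
          smul_eq_mul, mul_add]
      simp only [Finset.mul_sum, mul_left_comm (a * b), hi]
      simp only [jensenGap, smul_eq_mul, Finset.mul_sum]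
      rw [← Finset.sum_add_distrib, ← Finset.sum_sub_distrib]
      exact Finset.sum_congr rfl fun i _ => by ring
    rw [hgap]
    refine mul_le_mul_of_nonneg_left ?_ (mul_nonneg ha hb)
    conv_lhs => rw [← e.sum_repr (Q (u - v))]
    refine (norm_sum_le _ _).trans (Finset.sum_le_sum fun i _ => ?_)
    rw [norm_smul, mul_comm]
    refine mul_le_mul_of_nonneg_left ?_ (norm_nonneg _)
    have h := hq i (u - v)
    rw [Module.Basis.coord_apply] at h
    rw [h, Real.norm_eq_abs]
    have n₁ := (h₁ i).2.2 (u - v)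
    have n₂ := (h₂ i).2.2 (u - v)
    exact abs_le.2 ⟨by linarith, by linarith⟩

theorem proposition2p7 {X Y Z : Type*} [NormedAddCommGroup X] [NormedSpace ℝ X]
    [NormedAddCommGroup Y] [NormedSpace ℝ Y] [NormedAddCommGroup Z] [NormedSpace ℝ Z]
    (C : Set X) (hCo : IsOpen C) (hCc : Convex ℝ C)
    (F : X → Y) (hF : IsDCOn C F)
    (Q : Y → Z) (hQ : IsQuadratic Q) (hQc : Continuous Q)
    (h : (∃ p : Seminorm ℝ Y, IsEquivalentNorm p ∧ HasModulusOfConvexityPowerTypeTwo p) ∨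
      (FiniteDimensional ℝ Z ∧ HasPropertyD Y)) :
    IsDCOn C (fun x => Q (F x)) := by
  rcases h with ⟨p, hp, hp2⟩ | ⟨hZ, hY⟩
  · exact hF.quadratic_comp_of_powerTypeTwo hCo hCc hQ hQc hp hp2
  · exact hF.quadratic_comp_of_hasPropertyD hCo hCc hQ hQc hY
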